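/- **Theorem.** Let $B_n$ be the braid group on $n$ strings with Artin generators $\sigma_1,\dots,\sigma_{n-1}$, and let $lk:B_n\to\mathbb Z$ be the homomorphism with $lk(\sigma_i)=1$ for all $i$. For $\beta\in B_n$ let $\widehat\beta$ denote its closure, an oriented link in $S^3$. A *completing braid* for $\beta$ is a braid $\alpha\in B_n$ such that $\widehat{\alpha\beta}$ is a knot and $\widehat\alpha$ is a $k$-component unlink for some $1\le k\le n$. Let $I$ be a real-valued invariant of (isotopy classes of oriented) knots in $S^3$ such that for every knot $K$ and every diagram $D$ of $K$ $$1+w(D)-o(D)\;\le\; I(K)\;\le\; -1+w(D)+o(D),$$ where $w(D)$ is the number of positive minus the number of negative crossings of $D$, and $o(D)$ is the number of Seifert circles of $D$. Fix a completing braid $\alpha_\beta$ for every $\beta\in B_n$, define $\widehat I:B_n\to\mathbb R$ by $\widehat I(\beta)=I(\widehat{\alpha_\beta\beta})$, and suppose that $\widehat I$ is a quasi-morphism, i.e. $|\widehat I(\beta\gamma)-\widehat I(\beta)-\widehat I(\gamma)|\le C$ for some constant $C>0$ and all $\beta,\gamma\in B_n$. Then for every $\beta\in B_n$ the limit $$\widetilde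 I(\beta)=\lim_{p\to+\infty}\frac{\widehat I(\beta^p)}{p}$$ that defines the homogenization $\widetilde I$ of $\widehat I$ exists, and $\widetilde I(\beta)=lk(\beta)$; that is, $\widetilde I=lk$. -/

import Mathlib

open Filter Topology

/-! ## Oriented link diagrams

An oriented link diagram in the plane in general position with respect to the height function is
cut by horizontal lines into slices, each of which contains exactly one local minimum, local maximum
or crossing.  It is recorded as the list of its slices, read from the bottom to the top.  Every link
diagram is of this form after an isotopy of the plane.  A horizontal level is recorded as the list
of the directions of the strands that meet it, from left to right (`true` = upwards,
`false` = downwards). -/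

/-- The elementary pieces of an oriented diagram. -/
inductive Piece : Type
  /-- A local minimum; its left leg has direction `e`. -/
  | cup (e : Bool)
  /-- A local maximum; its left leg has direction `e`. -/
  | cap (e : Bool)
  /-- A crossing.  The strand from bottom left to top right has direction `a`, the strand from
  bottom right to top left has direction `b`.  The former is the overstrand iff `p = true`. -/
  | cross (a b p : Bool)

namespace Piece

/-- The directions of the strands at the bottom of a piece. -/
def dom : Piece → List Bool
  | cup _ => []
  | cap e => [e, !e]
  | cross a b _ => [a, b]

/-- The directions of the strands at the top of a piece. -/
def cod : Piece → List Bool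
  | cup e => [e, !e]
  | cap _ => []
  | cross a b _ => [b, a]

end Piece

/-- A slice: an elementary piece with vertical strands to its left and to its right. -/
structure Slice where
  left : List Bool
  piece : Piece
  right : List Bool

namespace Slice

/-- The directions of the strands at the bottom of a slice. -/
def dom (x : Slice) : List Bool := x.left ++ x.piece.dom ++ x.right

/-- The directions of the strands at the top of a slice. -/
def cod (x : Slice) : List Bool := x.left ++ x.piece.cod ++ x.right

end Slice

/-- The slices in the list fit on top of each other, with bottom level `s` and top level `t`. -/
def IsTangle : List Bool → List Slice → List Bool → Prop
  | s, [], t => s = t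
  | s, x :: w, t => x.dom = s ∧ IsTangle x.cod w t

theorem IsTangle.append {s t u : List Bool} {v w : List Slice} (hv : IsTangle s v t)
    (hw : IsTangle t w u) : IsTangle s (v ++ w) u := by
  induction v generalizing s with
  | nil => cases hv; exact hw
  | cons x v ih => exact ⟨hv.1, ih hv.2⟩

/-- An oriented link diagram. -/
structure LinkDiagram where
  slices : List Slice
  closed : IsTangle [] slices []

/-! ### Components, writhe and Seifert circles -/

/-- `(k, j)` stands for the `j`-th point (from the left) of the diagram on the level directly below
the `k`-th slice. -/
def IsPoint (w : List Slice) (q : ℕ × ℕ) : Prop :=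
  ∃ x, w[q.1]? = some x ∧ q.2 < x.dom.length

/-- Two points are joined by an arc inside of a single slice. -/
inductive JoinedInSlice (w : List Slice) : ℕ × ℕ → ℕ × ℕ → Prop
  | left (k j : ℕ) (x : Slice) : w[k]? = some x → j < x.left.length →
      JoinedInSlice w (k, j) (k + 1, j)
  | right (k j : ℕ) (x : Slice) : w[k]? = some x → j < x.right.length →
      JoinedInSlice w (k, x.left.length + x.piece.dom.length + j)
        (k + 1, x.left.length + x.piece.cod.length + j)
  | cup (k : ℕ) (l r : List Bool) (e : Bool) : w[k]? = some ⟨l, .cup e, r⟩ →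
      JoinedInSlice w (k + 1, l.length) (k + 1, l.length + 1)
  | cap (k : ℕ) (l r : List Bool) (e : Bool) : w[k]? = some ⟨l, .cap e, r⟩ →
      JoinedInSlice w (k, l.length) (k, l.length + 1)
  | cross_right (k : ℕ) (l r : List Bool) (a b p : Bool) : w[k]? = some ⟨l, .cross a b p, r⟩ →
      JoinedInSlice w (k, l.length) (k + 1, l.length + 1)
  | cross_left (k : ℕ) (l r : List Bool) (a b p : Bool) : w[k]? = some ⟨l, .cross a b p, r⟩ →
      JoinedInSlice w (k, l.length + 1) (k + 1, l.length)

/-- The number of closed curves that make up a diagram: the classes of its points under the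
equivalence relation generated by being joined inside of a slice. -/
noncomputable def curveCount (w : List Slice) : ℕ :=
  Nat.card (Quot fun q r : {q : ℕ × ℕ // IsPoint w q} => JoinedInSlice w q.1 r.1)

/-- The sign of a crossing (and zero for the other pieces).  A crossing of two upward strands is
positive iff the strand from bottom left to top right is the overstrand, and reversing one of the
two strands changes the sign. -/
def Piece.sign : Piece → ℤ
  | .cross a b p => if (a == b) = p then 1 else -1
  | _ => 0

/-- The smoothing of a slice according to the orientation: two parallel strands become two vertical
strands, and two antiparallel ones become a local maximum below a local minimum. -/
def Slice.smooth : Slice → List Slice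
  | ⟨l, .cross a b _, r⟩ => if a = b then [] else [⟨l, .cap a, r⟩, ⟨l, .cup b, r⟩]
  | x => [x]

namespace LinkDiagram

/-- The number of components of the link. -/
noncomputable def componentCount (D : LinkDiagram) : ℕ := curveCount D.slices

/-- The writhe `w(D)`: the number of positive minus the number of negative crossings. -/
def writhe (D : LinkDiagram) : ℤ := (D.slices.map fun x => x.piece.sign).sum

/-- The number `o(D)` of Seifert circles: the number of closed curves after all crossings have been
smoothed. -/
noncomputable def seifertCount (D : LinkDiagram) : ℕ := curveCount (D.slices.flatMap Slice.smooth)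

end LinkDiagram

/-! ### Isotopy of links -/

/-- The local moves: isotopies of the plane (the first five) and Reidemeister moves. -/
inductive Move : List Slice → List Slice → Prop
  /-- Two distant pieces exchange their heights. -/
  | exchange (l m r : List Bool) (x y : Piece) :
      Move [⟨l, x, m ++ y.dom ++ r⟩, ⟨l ++ x.cod ++ m, y, r⟩]
        [⟨l ++ x.dom ++ m, y, r⟩, ⟨l, x, m ++ y.cod ++ r⟩]
  /-- A local minimum and a local maximum to the left of it cancel. -/
  | zigzag_left (l r : List Bool) (a : Bool) :
      Move [⟨l ++ [a], .cup (!a), r⟩, ⟨l, .cap a, a :: r⟩] []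
  /-- A local minimum and a local maximum to the right of it cancel. -/
  | zigzag_right (l r : List Bool) (a : Bool) :
      Move [⟨l, .cup a, a :: r⟩, ⟨l ++ [a], .cap (!a), r⟩] []
  /-- A local minimum passes through a crossing with a transversal strand. -/
  | slide_cup (l r : List Bool) (e c p : Bool) :
      Move [⟨l, .cup e, c :: r⟩, ⟨l ++ [e], .cross (!e) c p, r⟩]
        [⟨l ++ [c], .cup e, r⟩, ⟨l, .cross c e (!p), (!e) :: r⟩]
  /-- A local maximum passes through a crossing with a transversal strand. -/
  | slide_cap (l r : List Bool) (e c p : Bool) :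
      Move [⟨l ++ [e], .cross c (!e) p, r⟩, ⟨l, .cap e, c :: r⟩]
        [⟨l, .cross e c (!p), (!e) :: r⟩, ⟨l ++ [c], .cap e, r⟩]
  /-- The first Reidemeister move, at a local minimum. -/
  | reidemeister_one_cup (l r : List Bool) (e p : Bool) :
      Move [⟨l, .cup e, r⟩, ⟨l, .cross e (!e) p, r⟩] [⟨l, .cup (!e), r⟩]
  /-- The first Reidemeister move, at a local maximum. -/
  | reidemeister_one_cap (l r : List Bool) (e p : Bool) :
      Move [⟨l, .cross e (!e) p, r⟩, ⟨l, .cap (!e), r⟩] [⟨l, .cap e, r⟩]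
  /-- The second Reidemeister move. -/
  | reidemeister_two (l r : List Bool) (a b p : Bool) :
      Move [⟨l, .cross a b p, r⟩, ⟨l, .cross b a (!p), r⟩] []
  /-- The third Reidemeister move for strands `a`, `b`, `c`.  Here `p`, `q`, `s` tell whether `a` is
  over `b`, `a` is over `c`, `b` is over `c`, respectively; the condition says that one of the three
  strands lies above the two others and one lies below the two others. -/
  | reidemeister_three (l r : List Bool) (a b c p q s : Bool) (h : q = p ∨ q = s) :
      Move [⟨l, .cross a b p, c :: r⟩, ⟨l ++ [b], .cross a c q, r⟩, ⟨l, .cross b c s, a :: r⟩]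
        [⟨l ++ [a], .cross b c s, r⟩, ⟨l, .cross a c q, b :: r⟩, ⟨l ++ [c], .cross a b p, r⟩]

/-- One diagram arises from the other by a single local move. -/
def LinkDiagram.MovesTo (D E : LinkDiagram) : Prop :=
  ∃ u v x y, Move x y ∧ D.slices = u ++ x ++ v ∧ E.slices = u ++ y ++ v

/-- Isotopy classes of oriented links in the three-sphere: link diagrams up to the equivalence
relation that is generated by isotopies of the plane and Reidemeister moves. -/
def Link : Type := Quot LinkDiagram.MovesTo

/-- `D` is a diagram of the link `L`. -/
def LinkDiagram.IsDiagramOf (D : LinkDiagram) (L : Link) : Prop := Quot.mk _ D = L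

/-- A link is a knot if it has exactly one component. -/
def Link.IsKnot (L : Link) : Prop := ∃ D : LinkDiagram, D.IsDiagramOf L ∧ D.componentCount = 1

/-- Isotopy classes of oriented knots in the three-sphere.  A real-valued knot invariant is a
function `Knot → ℝ`. -/
def Knot : Type := {L : Link // L.IsKnot}

/-- The slices of the crossingless diagram of `k` unnested circles, one above the other. -/
def circles : ℕ → List Slice
  | 0 => []
  | k + 1 => ⟨[], .cup true, []⟩ :: ⟨[], .cap true, []⟩ :: circles k

theorem isTangle_circles (k : ℕ) : IsTangle [] (circles k) [] := by
  induction k with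
  | zero => rfl
  | succ k ih => exact ⟨rfl, rfl, ih⟩

/-- The unlink with `k` components. -/
def unlink (k : ℕ) : Link := Quot.mk _ ⟨circles k, isTangle_circles k⟩

/-! ## Braids -/

/-- The relations of the Artin presentation, for the generators `σ 0, …, σ (n - 2)`. -/
def braidRels (n : ℕ) : Set (FreeGroup (Fin (n - 1))) :=
  {r | ∃ i j : Fin (n - 1), (j : ℕ) = i + 1 ∧
      r = (FreeGroup.of i * FreeGroup.of j * FreeGroup.of i) *
        (FreeGroup.of j * FreeGroup.of i * FreeGroup.of j)⁻¹} ∪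
  {r | ∃ i j : Fin (n - 1), (i : ℕ) + 2 ≤ j ∧
      r = (FreeGroup.of i * FreeGroup.of j) * (FreeGroup.of j * FreeGroup.of i)⁻¹}

/-- The braid group `B_n` on `n` strings. -/
abbrev BraidGroup (n : ℕ) : Type := PresentedGroup (braidRels n)

/-- The braid that is represented by a word in the Artin generators; `(i, true)` stands for the
`i`-th generator and `(i, false)` for its inverse. -/
def braidOfWord {n : ℕ} (w : List (Fin (n - 1) × Bool)) : BraidGroup n :=
  PresentedGroup.mk (braidRels n) (FreeGroup.mk w)

theorem lk_aux (n : ℕ) : ∀ r ∈ braidRels n,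
    FreeGroup.lift (fun _ : Fin (n - 1) => Multiplicative.ofAdd (1 : ℤ)) r = 1 := by
  rintro r (⟨i, j, -, rfl⟩ | ⟨i, j, -, rfl⟩) <;> simp

/-- The linking number homomorphism `lk : B_n → ℤ`, which maps each Artin generator to `1`. -/
def lk {n : ℕ} : BraidGroup n →* Multiplicative ℤ := PresentedGroup.toGroup (lk_aux n)

/-! ### The closure of a braid -/

/-- The slice of a letter of a braid word: the strings run upwards, and to the right of them are the
`n` downward strands of the closure.  The generators give positive crossings. -/
def letterSlice (n : ℕ) (x : Fin (n - 1) × Bool) : Slice :=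
  ⟨List.replicate x.1 true, .cross true true x.2,
    List.replicate (n - 2 - x.1) true ++ List.replicate n false⟩

/-- `n` nested local minima. -/
def nestedCups : ℕ → List Slice
  | 0 => []
  | n + 1 => nestedCups n ++ [⟨List.replicate n true, .cup true, List.replicate n false⟩]

/-- `n` nested local maxima. -/
def nestedCaps : ℕ → List Slice
  | 0 => []
  | n + 1 => ⟨List.replicate n true, .cap true, List.replicate n false⟩ :: nestedCaps n

theorem replicate_level (n : ℕ) :
    List.replicate n true ++ [true, false] ++ List.replicate n false =
      List.replicate (n + 1) true ++ List.replicate (n + 1) false := by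
  rw [List.replicate_succ' (a := true), List.replicate_succ (a := false)]
  simp

theorem isTangle_nestedCups (n : ℕ) :
    IsTangle [] (nestedCups n) (List.replicate n true ++ List.replicate n false) := by
  induction n with
  | zero => rfl
  | succ n ih =>
    refine ih.append ⟨?_, ?_⟩
    · simp [Slice.dom, Piece.dom]
    · exact replicate_level n

theorem isTangle_nestedCaps (n : ℕ) :
    IsTangle (List.replicate n true ++ List.replicate n false) (nestedCaps n) [] := by
  induction n with
  | zero => rfl
  | succ n ih =>
    refine ⟨replicate_level n, ?_⟩
    simpa [Slice.cod, Piece.cod] using ih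

theorem letterSlice_dom (n : ℕ) (x : Fin (n - 1) × Bool) :
    (letterSlice n x).dom = List.replicate n true ++ List.replicate n false := by
  have h : (x.1 : ℕ) + (2 + (n - 2 - x.1)) = n := by have := x.1.2; omega
  have e : List.replicate n true = List.replicate x.1 true ++
      ([true, true] ++ List.replicate (n - 2 - x.1) true) := by
    conv_lhs => rw [← h]
    rw [List.replicate_add, List.replicate_add]
    rfl
  rw [e]
  simp [letterSlice, Slice.dom, Piece.dom]

theorem letterSlice_cod (n : ℕ) (x : Fin (n - 1) × Bool) :
    (letterSlice n x).cod = List.replicate n true ++ List.replicate n false :=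
  letterSlice_dom n x

theorem isTangle_letters (n : ℕ) (w : List (Fin (n - 1) × Bool)) :
    IsTangle (List.replicate n true ++ List.replicate n false) (w.map (letterSlice n))
      (List.replicate n true ++ List.replicate n false) := by
  induction w with
  | nil => rfl
  | cons x w ih => exact ⟨letterSlice_dom n x, by rw [letterSlice_cod]; exact ih⟩

/-- The diagram of the closure of a braid word: the braid, read from the bottom to the top, whose
strings run upwards and are closed up by `n` parallel strands to the right of it. -/
def closureDiagram {n : ℕ} (w : List (Fin (n - 1) × Bool)) : LinkDiagram where
  slices := nestedCups n ++ w.map (letterSlice n) ++ nestedCaps n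
  closed := ((isTangle_nestedCups n).append (isTangle_letters n w)).append (isTangle_nestedCaps n)

/-- The closure of a braid word as a link. -/
def wordClosure {n : ℕ} (w : List (Fin (n - 1) × Bool)) : Link := Quot.mk _ (closureDiagram w)

theorem wordClosure_move {n : ℕ} (u v x y : List (Fin (n - 1) × Bool))
    (h : Move (x.map (letterSlice n)) (y.map (letterSlice n))) :
    wordClosure (u ++ x ++ v) = wordClosure (u ++ y ++ v) :=
  Quot.sound ⟨nestedCups n ++ u.map (letterSlice n), v.map (letterSlice n) ++ nestedCaps n, _, _, h,
    by simp [closureDiagram], by simp [closureDiagram]⟩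

/-- Two braid words are related if replacing one by the other does not change the closure of any
braid word. -/
def wordCon (n : ℕ) : Con (FreeMonoid (Fin (n - 1) × Bool)) where
  r x y := ∀ u v : FreeMonoid (Fin (n - 1) × Bool),
    wordClosure (FreeMonoid.toList (u * x * v)) = wordClosure (FreeMonoid.toList (u * y * v))
  iseqv := ⟨fun _ _ _ => rfl, fun h u v => (h u v).symm, fun h k u v => (h u v).trans (k u v)⟩
  mul' := by
    intro x x' y y' h k u v
    have h1 := h u (y * v)
    have h2 := k (u * x') v
    simp only [mul_assoc] at h1 h2 ⊢
    exact h1.trans h2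

/-- The class of a letter. -/
def letterClass (n : ℕ) (x : Fin (n - 1) × Bool) : (wordCon n).Quotient :=
  ((FreeMonoid.of x : FreeMonoid (Fin (n - 1) × Bool)) : (wordCon n).Quotient)

theorem letterClass_inv (n : ℕ) (i : Fin (n - 1)) (b : Bool) :
    letterClass n (i, b) * letterClass n (i, !b) = 1 := by
  refine (Con.eq (wordCon n)).2 fun u v => ?_
  exact wordClosure_move u.toList v.toList [(i, b), (i, !b)] []
    (Move.reidemeister_two _ _ true true b)

theorem letterClass_far (n : ℕ) (i j : Fin (n - 1)) (h : (i : ℕ) + 2 ≤ j) :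
    letterClass n (i, true) * letterClass n (j, true) =
      letterClass n (j, true) * letterClass n (i, true) := by
  refine (Con.eq (wordCon n)).2 fun u v => ?_
  refine wordClosure_move u.toList v.toList [(i, true), (j, true)] [(j, true), (i, true)] ?_
  have hj := j.2
  have h1 : n - 2 - (i : ℕ) = (j - i - 2) + (2 + (n - 2 - j)) := by omega
  have h2 : (j : ℕ) = i + (2 + (j - i - 2)) := by omega
  have key := Move.exchange (List.replicate i true) (List.replicate (j - i - 2) true)
    (List.replicate (n - 2 - j) true ++ List.replicate n false)
    (.cross true true true) (.cross true true true)
  have e1 : List.replicate (n - 2 - (i : ℕ)) true ++ List.replicate n false =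
      List.replicate (j - i - 2) true ++ [true, true] ++
        (List.replicate (n - 2 - j) true ++ List.replicate n false) := by
    rw [h1, List.replicate_add, List.replicate_add]
    simp [List.replicate]
  have e2 : List.replicate (j : ℕ) true =
      List.replicate i true ++ [true, true] ++ List.replicate (j - i - 2) true := by
    conv_lhs => rw [h2]
    rw [List.replicate_add, List.replicate_add]
    simp [List.replicate]
  simp only [List.map, letterSlice]
  rw [e1, e2]
  exact key

theorem letterClass_braid (n : ℕ) (i j : Fin (n - 1)) (h : (j : ℕ) = i + 1) :
    letterClass n (i, true) * letterClass n (j, true) * letterClass n (i, true) =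
      letterClass n (j, true) * letterClass n (i, true) * letterClass n (j, true) := by
  refine (Con.eq (wordCon n)).2 fun u v => ?_
  refine wordClosure_move u.toList v.toList [(i, true), (j, true), (i, true)]
    [(j, true), (i, true), (j, true)] ?_
  have hj := j.2
  have h1 : n - 2 - (i : ℕ) = (n - 2 - j) + 1 := by omega
  have key := Move.reidemeister_three (List.replicate i true)
    (List.replicate (n - 2 - j) true ++ List.replicate n false) true true true true true true
    (Or.inl rfl)
  have e1 : List.replicate (n - 2 - (i : ℕ)) true ++ List.replicate n false =
      true :: (List.replicate (n - 2 - j) true ++ List.replicate n false) := by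
    rw [h1, List.replicate_succ, List.cons_append]
  have e2 : List.replicate (j : ℕ) true = List.replicate i true ++ [true] := by
    rw [h, List.replicate_succ']
  simp only [List.map, letterSlice]
  rw [e1, e2]
  exact key

/-- The class of an Artin generator, as an invertible element. -/
def generatorUnit (n : ℕ) (i : Fin (n - 1)) : ((wordCon n).Quotient)ˣ :=
  ⟨letterClass n (i, true), letterClass n (i, false), letterClass_inv n i true,
    letterClass_inv n i false⟩

theorem generatorUnit_rels (n : ℕ) :
    ∀ r ∈ braidRels n, FreeGroup.lift (generatorUnit n) r = 1 := by
  rintro r (⟨i, j, h, rfl⟩ | ⟨i, j, h, rfl⟩)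
  · rw [map_mul, map_inv, mul_inv_eq_one]
    simp only [map_mul, FreeGroup.lift_apply_of]
    exact Units.ext (letterClass_braid n i j h)
  · rw [map_mul, map_inv, mul_inv_eq_one]
    simp only [map_mul, FreeGroup.lift_apply_of]
    exact Units.ext (letterClass_far n i j h)

/-- The closure of a braid as a link.  It is well-defined on the braid group because the braid
relations and the cancellation of inverse letters are realized by the local moves. -/
def braidClosure {n : ℕ} (β : BraidGroup n) : Link :=
  Con.liftOn ((PresentedGroup.toGroup (generatorUnit_rels n) β : ((wordCon n).Quotient)ˣ) :
      (wordCon n).Quotient)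
    (fun w => wordClosure (FreeMonoid.toList w))
    (fun x y h => by simpa using h 1 1)

/-- The closure of a braid is the closure of any word that represents the braid. -/
theorem braidClosure_braidOfWord {n : ℕ} (w : List (Fin (n - 1) × Bool)) :
    braidClosure (braidOfWord w) = wordClosure w := by
  have key : ((PresentedGroup.toGroup (generatorUnit_rels n) (braidOfWord w) :
      ((wordCon n).Quotient)ˣ) : (wordCon n).Quotient) =
      ((FreeMonoid.ofList w : FreeMonoid (Fin (n - 1) × Bool)) : (wordCon n).Quotient) := by
    have h0 : PresentedGroup.toGroup (generatorUnit_rels n) (braidOfWord w) =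
        FreeGroup.lift (generatorUnit n) (FreeGroup.mk w) := rfl
    rw [h0, FreeGroup.lift_mk]
    induction w with
    | nil => rfl
    | cons x w ih =>
      have ih' := ih rfl
      rw [List.map_cons, List.prod_cons, Units.val_mul, ih']
      obtain ⟨i, b⟩ := x
      cases b <;> rfl
  unfold braidClosure
  rw [key]
  rfl

/-! ## Functions on braid groups that are induced by knot invariants -/

/-- `α` is a completing braid for `β`: the closure of `α β` is a knot, and the closure of `α` is an
unlink with `k` components for some `1 ≤ k ≤ n`. -/
structure IsCompletingBraid {n : ℕ} (β α : BraidGroup n) : Prop where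
  isKnot : (braidClosure (α * β)).IsKnot
  isUnlink : ∃ k : ℕ, 1 ≤ k ∧ k ≤ n ∧ braidClosure α = unlink k

/-- The function on the braid group induced by a knot invariant `I` and a choice of completing
braids: `β` is mapped to the value of `I` at the closure of `α β * β`. -/
def inducedFunction {n : ℕ} (I : Knot → ℝ) (α : BraidGroup n → BraidGroup n)
    (hα : ∀ β, IsCompletingBraid β (α β)) (β : BraidGroup n) : ℝ :=
  I ⟨braidClosure (α β * β), (hα β).isKnot⟩

/-- Quasi-morphisms on a group. -/
def IsQuasimorphism {G : Type*} [Group G] (φ : G → ℝ) : Prop :=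
  ∃ C : ℝ, 0 < C ∧ ∀ a b : G, |φ (a * b) - φ a - φ b| ≤ C

/-- The homogenization of a quasi-morphism. -/
noncomputable def homogenization {G : Type*} [Group G] (φ : G → ℝ) (a : G) : ℝ :=
  limUnder atTop fun k : ℕ => φ (a ^ k) / k

/-!
Write `o` for the number of Seifert circles of the closure of a braid word, which depends only on
the number of strings.  The Bennequin bounds put the value of `I` at a closed braid `β` within
`o - 1` of `lk β`.  Hence `Î(β) - lk β` is, up to a bounded error, the linking number of the
completing braid of `β`.  If `β` is pure, then the closure of its completing braid `α` has as many
components as the closure of `α β`, that is, `α` closes up to the unknot, and the Bennequin bounds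
control `lk α`.  So `Î - lk` is a quasi-morphism that is bounded on the finite-index subgroup of
pure braids, hence on the whole braid group, and homogenization does not see bounded errors.

Components are compared through 2-colourings: a link with `k` components has `2 ^ k` of them.
-/

/-! ## Two-colourings of tangles -/

/-- The 2-colourings of the top of a piece that extend a given 2-colouring of its bottom, where a
colouring is constant along each strand.  A colouring of the wrong length has no extension. -/
def Piece.extensions : Piece → List Bool → Multiset (List Bool)
  | cup _, [] => {[false, false], [true, true]}
  | cap _, [u, v] => if u = v then {[]} else 0
  | cross _ _ _, [u, v] => {[v, u]}
  | _, _ => 0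

/-- The 2-colourings of the level above a slice that extend a given 2-colouring of the level
below. -/
def Slice.extensions (x : Slice) (a : List Bool) : Multiset (List Bool) :=
  (x.piece.extensions ((a.drop x.left.length).take x.piece.dom.length)).map fun b =>
    a.take x.left.length ++ (b ++ a.drop (x.left.length + x.piece.dom.length))

/-- The 2-colourings of the top level of a tangle, each counted as often as it arises from a
2-colouring of the whole tangle that extends the given one of the bottom level. -/
def tangleExtensions : List Slice → List Bool → Multiset (List Bool)
  | [], a => {a}
  | x :: w, a => (x.extensions a).bind (tangleExtensions w)

theorem exists_eq_append_append_of_length_eq {α β : Type*} {a : List α} {l m r : List β}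
    (h : a.length = (l ++ m ++ r).length) :
    ∃ a₁ a₂ a₃, a = a₁ ++ (a₂ ++ a₃) ∧ a₁.length = l.length ∧ a₂.length = m.length ∧
      a₃.length = r.length := by
  rw [List.length_append, List.length_append] at h
  refine ⟨a.take l.length, (a.drop l.length).take m.length, (a.drop l.length).drop m.length,
    by simp only [List.take_append_drop], ?_, ?_, ?_⟩ <;>
  simp only [List.length_take, List.length_drop] <;> omega

namespace Piece

theorem length_of_mem_extensions {x : Piece} {a b : List Bool} (hb : b ∈ x.extensions a) :
    b.length = x.cod.length := by
  have all_length_eq : ∀ c ∈ x.extensions a, c.length = x.cod.length := by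
    fun_cases extensions x a <;> simp [cod]
  exact all_length_eq b hb

theorem nodup_extensions (x : Piece) (a : List Bool) : (x.extensions a).Nodup := by
  fun_cases extensions x a <;> simp

end Piece

namespace Slice

theorem extensions_append {l a b : List Bool} (ha : a.length = l.length) (x : Piece)
    (hb : b.length = x.dom.length) (r c : List Bool) :
    extensions ⟨l, x, r⟩ (a ++ (b ++ c)) = (x.extensions b).map fun b' => a ++ (b' ++ c) := by
  simp [extensions, ← ha, ← hb, ← List.drop_drop]

theorem exists_of_mem_extensions {x : Slice} {a b : List Bool} (ha : a.length = x.dom.length)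
    (hb : b ∈ x.extensions a) :
    ∃ a₁ a₂ b₂ a₃, a = a₁ ++ (a₂ ++ a₃) ∧ b = a₁ ++ (b₂ ++ a₃) ∧
      a₁.length = x.left.length ∧ a₂.length = x.piece.dom.length ∧ a₃.length = x.right.length ∧
      b₂ ∈ x.piece.extensions a₂ := by
  obtain ⟨a₁, a₂, a₃, rfl, h₁, h₂, h₃⟩ := exists_eq_append_append_of_length_eq ha
  rw [extensions_append h₁ _ h₂] at hb
  obtain ⟨b₂, hb₂, rfl⟩ := Multiset.mem_map.1 hb
  exact ⟨a₁, a₂, b₂, a₃, rfl, rfl, h₁, h₂, h₃, hb₂⟩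

theorem length_of_mem_extensions {x : Slice} {a b : List Bool} (ha : a.length = x.dom.length)
    (hb : b ∈ x.extensions a) : b.length = x.cod.length := by
  obtain ⟨a₁, a₂, b₂, a₃, rfl, rfl, h₁, -, h₃, hb₂⟩ := exists_of_mem_extensions ha hb
  simp only [cod, List.length_append, h₁, h₃, Piece.length_of_mem_extensions hb₂, add_assoc]

theorem nodup_extensions (x : Slice) (a : List Bool) : (x.extensions a).Nodup :=
  (x.piece.nodup_extensions _).map fun b b' h => by simpa using h

/-- The slice `x` with further vertical strands `l` to its left and `r` to its right. -/
def frame (l r : List Bool) (x : Slice) : Slice := ⟨l ++ x.left, x.piece, x.right ++ r⟩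

theorem extensions_frame {l a b : List Bool} {x : Slice} (ha : a.length = l.length)
    (hb : b.length = x.dom.length) (r c : List Bool) :
    (x.frame l r).extensions (a ++ (b ++ c)) =
      (x.extensions b).map fun b' => a ++ (b' ++ c) := by
  obtain ⟨b₁, b₂, b₃, rfl, h₁, h₂, -⟩ := exists_eq_append_append_of_length_eq hb
  have h := extensions_append (l := l ++ x.left) (a := a ++ b₁) (by simp [ha, h₁]) x.piece h₂
    (x.right ++ r) (b₃ ++ c)
  simpa [frame, extensions_append h₁ x.piece h₂] using h

end Slice

theorem tangleExtensions_append (v w : List Slice) (a : List Bool) :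
    tangleExtensions (v ++ w) a = (tangleExtensions v a).bind (tangleExtensions w) := by
  induction v generalizing a with
  | nil => simp [tangleExtensions]
  | cons x v ih => simp only [List.cons_append, tangleExtensions, ih, Multiset.bind_assoc]

theorem tangleExtensions_singleton (x : Slice) (a : List Bool) :
    tangleExtensions [x] a = x.extensions a :=
  (Multiset.bind_singleton _ id).trans (Multiset.map_id _)

theorem length_of_mem_tangleExtensions {s t a b : List Bool} {w : List Slice}
    (hw : IsTangle s w t) (ha : a.length = s.length) (hb : b ∈ tangleExtensions w a) :
    b.length = t.length := by
  induction w generalizing s a with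
  | nil => cases hw; rw [Multiset.mem_singleton.1 hb, ha]
  | cons x w ih =>
    obtain ⟨rfl, hw⟩ := hw
    obtain ⟨c, hc, hb⟩ := Multiset.mem_bind.1 hb
    exact ih hw (Slice.length_of_mem_extensions ha hc) hb

theorem IsTangle.frame {s t : List Bool} {w : List Slice} (hw : IsTangle s w t)
    (l r : List Bool) : IsTangle (l ++ s ++ r) (w.map (Slice.frame l r)) (l ++ t ++ r) := by
  induction w generalizing s with
  | nil => cases hw; rfl
  | cons x w ih =>
    obtain ⟨rfl, hw⟩ := hw
    refine ⟨by simp [Slice.dom, Slice.frame], ?_⟩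
    simpa [Slice.cod, Slice.frame] using ih hw

theorem IsTangle.tangleExtensions_frame {s t l a b : List Bool} {w : List Slice}
    (hw : IsTangle s w t) (ha : a.length = l.length) (hb : b.length = s.length)
    (r c : List Bool) :
    tangleExtensions (w.map (Slice.frame l r)) (a ++ (b ++ c)) =
      (tangleExtensions w b).map fun b' => a ++ (b' ++ c) := by
  induction w generalizing s b with
  | nil => simp [tangleExtensions]
  | cons x w ih =>
    obtain ⟨rfl, hw⟩ := hw
    simp only [List.map_cons, tangleExtensions, Slice.extensions_frame ha hb, Multiset.bind_map,
      Multiset.map_bind]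
    exact Multiset.bind_congr fun b' hb' => ih hw (Slice.length_of_mem_extensions hb hb')

/-! ## Invariance under the local moves -/

/-- Two tangles with bottom level `s` that extend every 2-colouring of `s` in the same ways.  The
directions recorded in `s` matter only for `x` and `y` being tangles, not for the colourings. -/
structure SameExtensions (s : List Bool) (x y : List Slice) : Prop where
  isTangle_left : ∃ t, IsTangle s x t
  isTangle_right : ∃ t, IsTangle s y t
  eq_of_length : ∀ a : List Bool, a.length = s.length → tangleExtensions x a = tangleExtensions y a

namespace SameExtensions

theorem frame {s : List Bool} {x y : List Slice} (h : SameExtensions s x y) (l r : List Bool) :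
    SameExtensions (l ++ s ++ r) (x.map (Slice.frame l r)) (y.map (Slice.frame l r)) := by
  obtain ⟨⟨t, hx⟩, ⟨t', hy⟩, hxy⟩ := h
  refine ⟨⟨_, hx.frame l r⟩, ⟨_, hy.frame l r⟩, fun a ha => ?_⟩
  obtain ⟨a₁, b, a₃, rfl, h₁, hb, -⟩ := exists_eq_append_append_of_length_eq ha
  rw [hx.tangleExtensions_frame h₁ hb, hy.tangleExtensions_frame h₁ hb, hxy b hb]

theorem zigzag_left (a : Bool) :
    SameExtensions [a] [⟨[a], .cup (!a), []⟩, ⟨[], .cap a, [a]⟩] [] := by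
  refine ⟨⟨[a], ?_⟩, ⟨_, rfl⟩, fun b hb => ?_⟩
  · cases a <;> exact ⟨rfl, rfl, rfl⟩
  · obtain ⟨u, rfl⟩ := List.length_eq_one_iff.1 hb
    decide +revert

theorem zigzag_right (a : Bool) :
    SameExtensions [a] [⟨[], .cup a, [a]⟩, ⟨[a], .cap (!a), []⟩] [] := by
  refine ⟨⟨[a], ?_⟩, ⟨_, rfl⟩, fun b hb => ?_⟩
  · cases a <;> exact ⟨rfl, rfl, rfl⟩
  · obtain ⟨u, rfl⟩ := List.length_eq_one_iff.1 hb
    decide +revert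

theorem slide_cup (e c p : Bool) :
    SameExtensions [c] [⟨[], .cup e, [c]⟩, ⟨[e], .cross (!e) c p, []⟩]
      [⟨[c], .cup e, []⟩, ⟨[], .cross c e (!p), [!e]⟩] := by
  refine ⟨⟨_, rfl, rfl, rfl⟩, ⟨_, rfl, rfl, rfl⟩, fun b hb => ?_⟩
  obtain ⟨u, rfl⟩ := List.length_eq_one_iff.1 hb
  decide +revert

theorem slide_cap (e c p : Bool) :
    SameExtensions [e, c, !e] [⟨[e], .cross c (!e) p, []⟩, ⟨[], .cap e, [c]⟩]
      [⟨[], .cross e c (!p), [!e]⟩, ⟨[c], .cap e, []⟩] := by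
  refine ⟨⟨_, rfl, rfl, rfl⟩, ⟨_, rfl, rfl, rfl⟩, fun b hb => ?_⟩
  obtain ⟨u, v, z, rfl⟩ := List.length_eq_three.1 hb
  decide +revert

theorem reidemeister_one_cup (e p : Bool) :
    SameExtensions [] [⟨[], .cup e, []⟩, ⟨[], .cross e (!e) p, []⟩] [⟨[], .cup (!e), []⟩] := by
  refine ⟨⟨_, rfl, rfl, rfl⟩, ⟨_, rfl, rfl⟩, fun b hb => ?_⟩
  obtain rfl := List.eq_nil_of_length_eq_zero hb
  decide +revert

theorem reidemeister_one_cap (e p : Bool) :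
    SameExtensions [e, !e] [⟨[], .cross e (!e) p, []⟩, ⟨[], .cap (!e), []⟩]
      [⟨[], .cap e, []⟩] := by
  refine ⟨⟨[], ?_⟩, ⟨_, rfl, rfl⟩, fun b hb => ?_⟩
  · cases e <;> exact ⟨rfl, rfl, rfl⟩
  · obtain ⟨u, v, rfl⟩ := List.length_eq_two.1 hb
    decide +revert

theorem reidemeister_two (a b p : Bool) :
    SameExtensions [a, b] [⟨[], .cross a b p, []⟩, ⟨[], .cross b a (!p), []⟩] [] := by
  refine ⟨⟨_, rfl, rfl, rfl⟩, ⟨_, rfl⟩, fun c hc => ?_⟩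
  obtain ⟨u, v, rfl⟩ := List.length_eq_two.1 hc
  decide +revert

theorem reidemeister_three (a b c p q s : Bool) :
    SameExtensions [a, b, c]
      [⟨[], .cross a b p, [c]⟩, ⟨[b], .cross a c q, []⟩, ⟨[], .cross b c s, [a]⟩]
      [⟨[a], .cross b c s, []⟩, ⟨[], .cross a c q, [b]⟩, ⟨[c], .cross a b p, []⟩] := by
  refine ⟨⟨_, rfl, rfl, rfl, rfl⟩, ⟨_, rfl, rfl, rfl, rfl⟩, fun d hd => ?_⟩
  obtain ⟨u, v, z, rfl⟩ := List.length_eq_three.1 hd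
  rfl

theorem exchange (m : List Bool) (x y : Piece) :
    SameExtensions (x.dom ++ m ++ y.dom)
      [⟨[], x, m ++ y.dom⟩, ⟨x.cod ++ m, y, []⟩] [⟨x.dom ++ m, y, []⟩, ⟨[], x, m ++ y.cod⟩] := by
  refine ⟨⟨x.cod ++ m ++ y.cod, ?_⟩, ⟨x.cod ++ m ++ y.cod, ?_⟩, fun a ha => ?_⟩
  · simp [IsTangle, Slice.dom, Slice.cod]
  · simp [IsTangle, Slice.dom, Slice.cod]
  obtain ⟨b, c, d, rfl, hb, hc, hd⟩ := exists_eq_append_append_of_length_eq ha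
  have extend_x (r d') : Slice.extensions ⟨[], x, r⟩ (b ++ (c ++ d')) =
      (x.extensions b).map (· ++ (c ++ d')) := by
    simpa using Slice.extensions_append (a := []) (l := []) rfl x hb r (c ++ d')
  have extend_y {l b' : List Bool} (hb' : b'.length = l.length) :
      Slice.extensions ⟨l ++ m, y, []⟩ (b' ++ (c ++ d)) =
        (y.extensions d).map fun d' => b' ++ (c ++ d') := by
    simpa using Slice.extensions_append (a := b' ++ c) (l := l ++ m) (by simp [hb', hc]) y hd [] []
  trans (x.extensions b).bind fun b' => (y.extensions d).map fun d' => b' ++ (c ++ d')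
  · rw [tangleExtensions, extend_x, Multiset.bind_map]
    refine Multiset.bind_congr fun b' hb' => ?_
    rw [tangleExtensions_singleton, extend_y (Piece.length_of_mem_extensions hb')]
  · rw [tangleExtensions, extend_y hb, Multiset.bind_map, Multiset.bind_map_comm]
    exact Multiset.bind_congr fun d' _ => by rw [tangleExtensions_singleton, extend_x]

end SameExtensions

theorem Move.exists_sameExtensions {x y : List Slice} (h : Move x y) :
    ∃ s, SameExtensions s x y := by
  cases h with
  | exchange l m r x y =>
    exact ⟨_, by simpa [Slice.frame] using (SameExtensions.exchange m x y).frame l r⟩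
  | zigzag_left l r a =>
    exact ⟨_, by simpa [Slice.frame] using (SameExtensions.zigzag_left a).frame l r⟩
  | zigzag_right l r a =>
    exact ⟨_, by simpa [Slice.frame] using (SameExtensions.zigzag_right a).frame l r⟩
  | slide_cup l r e c p =>
    exact ⟨_, by simpa [Slice.frame] using (SameExtensions.slide_cup e c p).frame l r⟩
  | slide_cap l r e c p =>
    exact ⟨_, by simpa [Slice.frame] using (SameExtensions.slide_cap e c p).frame l r⟩
  | reidemeister_one_cup l r e p =>
    exact ⟨_, by simpa [Slice.frame] using (SameExtensions.reidemeister_one_cup e p).frame l r⟩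
  | reidemeister_one_cap l r e p =>
    exact ⟨_, by simpa [Slice.frame] using (SameExtensions.reidemeister_one_cap e p).frame l r⟩
  | reidemeister_two l r a b p =>
    exact ⟨_, by simpa [Slice.frame] using (SameExtensions.reidemeister_two a b p).frame l r⟩
  | reidemeister_three l r a b c p q s _ =>
    exact ⟨_, by
      simpa [Slice.frame] using (SameExtensions.reidemeister_three a b c p q s).frame l r⟩

theorem Move.tangleExtensions_eq {x y : List Slice} (h : Move x y) {s t a : List Bool}
    (hx : IsTangle s x t) (ha : a.length = s.length) :
    tangleExtensions x a = tangleExtensions y a := by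
  obtain ⟨s', hxy⟩ := h.exists_sameExtensions
  obtain ⟨t', hx'⟩ := hxy.isTangle_left
  obtain ⟨p, w, rfl⟩ : ∃ p w, x = p :: w := by cases h <;> exact ⟨_, _, rfl⟩
  obtain rfl : s = s' := hx.1.symm.trans hx'.1
  exact hxy.eq_of_length a ha

theorem IsTangle.exists_of_append {s t : List Bool} {v w : List Slice}
    (h : IsTangle s (v ++ w) t) : ∃ u, IsTangle s v u ∧ IsTangle u w t := by
  induction v generalizing s with
  | nil => exact ⟨s, rfl, h⟩
  | cons x v ih =>
    obtain ⟨u, hv, hw⟩ := ih h.2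
    exact ⟨u, ⟨h.1, hv⟩, hw⟩

/-- The number of 2-colourings of a diagram, a substitute for the number of components: it is
computed level by level, and hence its invariance under the moves can be checked locally. -/
def LinkDiagram.coloringCount (D : LinkDiagram) : ℕ := (tangleExtensions D.slices []).card

theorem LinkDiagram.MovesTo.coloringCount_eq {D E : LinkDiagram} (h : D.MovesTo E) :
    D.coloringCount = E.coloringCount := by
  obtain ⟨u, v, x, y, hxy, hD, hE⟩ := h
  have hclosed := D.closed
  rw [hD, List.append_assoc] at hclosed
  obtain ⟨s, hu, hclosed⟩ := hclosed.exists_of_append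
  obtain ⟨t, hx, -⟩ := hclosed.exists_of_append
  simp only [coloringCount, hD, hE, List.append_assoc, tangleExtensions_append]
  refine congrArg Multiset.card (Multiset.bind_congr fun a ha => ?_)
  rw [hxy.tangleExtensions_eq hx (length_of_mem_tangleExtensions hu rfl ha)]

/-- The number of 2-colourings of a link that are constant on each component. -/
def Link.coloringCount : Link → ℕ :=
  Quot.lift LinkDiagram.coloringCount fun _ _ h => h.coloringCount_eq

theorem coloringCount_unlink (k : ℕ) : (unlink k).coloringCount = 2 ^ k := by
  change (tangleExtensions (circles k) []).card = 2 ^ k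
  induction k with
  | zero => rfl
  | succ k ih =>
    have circle : tangleExtensions [⟨[], .cup true, []⟩, ⟨[], .cap true, []⟩] [] = {[], []} := by
      decide
    change (tangleExtensions ([_, _] ++ circles k) []).card = 2 ^ (k + 1)
    rw [tangleExtensions_append, circle]
    simp [ih, pow_succ, mul_two]

/-! ## Colourings and components -/

/-- The 2-colourings of a tangle that extend a given one of the bottom level, as sequences of the
colourings of its levels.  The colouring of the top level is repeated forever. -/
def tangleColorings : List Slice → List Bool → Multiset (Stream' (List Bool))
  | [], a => {Stream'.const a}
  | x :: w, a => (x.extensions a).bind fun b => (tangleColorings w b).map (Stream'.cons a)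

theorem card_tangleColorings (w : List Slice) (a : List Bool) :
    (tangleColorings w a).card = (tangleExtensions w a).card := by
  induction w generalizing a with
  | nil => rfl
  | cons x w ih => simp [tangleColorings, tangleExtensions, Multiset.card_bind, ih]

theorem mem_tangleColorings_cons {x : Slice} {w : List Slice} {a : List Bool}
    {P : Stream' (List Bool)} :
    P ∈ tangleColorings (x :: w) a ↔
      ∃ b ∈ x.extensions a, ∃ Q ∈ tangleColorings w b, Stream'.cons a Q = P := by
  simp only [tangleColorings, Multiset.mem_bind, Multiset.mem_map]

theorem get_zero_of_mem_tangleColorings {w : List Slice} {a : List Bool}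
    {P : Stream' (List Bool)} (hP : P ∈ tangleColorings w a) : P.get 0 = a := by
  cases w with
  | nil => rw [Multiset.mem_singleton.1 hP]; rfl
  | cons x w =>
    obtain ⟨b, -, Q, -, rfl⟩ := mem_tangleColorings_cons.1 hP
    rfl

theorem nodup_tangleColorings (w : List Slice) (a : List Bool) : (tangleColorings w a).Nodup := by
  induction w generalizing a with
  | nil => exact Multiset.nodup_singleton _
  | cons x w ih =>
    refine Multiset.nodup_bind.2 ⟨fun b _ => (ih b).map (Stream'.cons_injective_right a), ?_⟩
    refine (x.nodup_extensions a).pairwise fun b _ c _ hbc => ?_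
    refine Multiset.disjoint_left.2 fun {P} hb hc => ?_
    obtain ⟨Q, hQ, rfl⟩ := Multiset.mem_map.1 hb
    obtain ⟨R, hR, hRQ⟩ := Multiset.mem_map.1 hc
    obtain rfl := Stream'.cons_injective_right a hRQ
    exact hbc ((get_zero_of_mem_tangleColorings hQ).symm.trans
      (get_zero_of_mem_tangleColorings hR))

theorem get_succ_mem_extensions {w : List Slice} {a : List Bool} {P : Stream' (List Bool)}
    (hP : P ∈ tangleColorings w a) {k : ℕ} {x : Slice} (hk : w[k]? = some x) :
    P.get (k + 1) ∈ x.extensions (P.get k) := by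
  induction w generalizing a P k with
  | nil => simp at hk
  | cons y w ih =>
    obtain ⟨b, hb, Q, hQ, rfl⟩ := mem_tangleColorings_cons.1 hP
    cases k with
    | zero =>
      obtain rfl : y = x := by simpa using hk
      exact (get_zero_of_mem_tangleColorings hQ).symm ▸ hb
    | succ k => exact ih hQ (by simpa using hk)

section

variable {s t a : List Bool} {w : List Slice} {P : Stream' (List Bool)}

theorem IsTangle.length_get (hw : IsTangle s w t) (ha : a.length = s.length)
    (hP : P ∈ tangleColorings w a) {k : ℕ} {x : Slice} (hk : w[k]? = some x) :
    (P.get k).length = x.dom.length := by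
  induction w generalizing s a P k with
  | nil => simp at hk
  | cons y w ih =>
    obtain ⟨rfl, hw⟩ := hw
    obtain ⟨b, hb, Q, hQ, rfl⟩ := mem_tangleColorings_cons.1 hP
    cases k with
    | zero =>
      obtain rfl : y = x := by simpa using hk
      exact ha
    | succ k => exact ih hw (Slice.length_of_mem_extensions ha hb) hQ (by simpa using hk)

theorem IsTangle.length_get_of_le (hw : IsTangle s w t) (ha : a.length = s.length)
    (hP : P ∈ tangleColorings w a) {k : ℕ} (hk : w.length ≤ k) :
    (P.get k).length = t.length := by
  induction w generalizing s a P k with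
  | nil => cases hw; rw [Multiset.mem_singleton.1 hP]; exact ha
  | cons y w ih =>
    obtain ⟨rfl, hw⟩ := hw
    obtain ⟨b, hb, Q, hQ, rfl⟩ := mem_tangleColorings_cons.1 hP
    obtain ⟨k, rfl⟩ := Nat.exists_eq_add_of_le' (Nat.one_le_of_lt hk)
    exact ih hw (Slice.length_of_mem_extensions ha hb) hQ (by simpa using hk)

end

namespace Slice

variable {x : Slice} {a b l r : List Bool}

theorem getElem?_left_of_mem_extensions (ha : a.length = x.dom.length) (hb : b ∈ x.extensions a)
    {j : ℕ} (hj : j < x.left.length) : b[j]? = a[j]? := by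
  obtain ⟨a₁, a₂, b₂, a₃, rfl, rfl, h₁, -, -, -⟩ := exists_of_mem_extensions ha hb
  rw [List.getElem?_append_left (h₁ ▸ hj), List.getElem?_append_left (h₁ ▸ hj)]

theorem getElem?_right_of_mem_extensions (ha : a.length = x.dom.length) (hb : b ∈ x.extensions a)
    (j : ℕ) :
    b[x.left.length + x.piece.cod.length + j]? = a[x.left.length + x.piece.dom.length + j]? := by
  obtain ⟨a₁, a₂, b₂, a₃, rfl, rfl, h₁, h₂, -, hb₂⟩ := exists_of_mem_extensions ha hb
  rw [← h₁, ← h₂, ← Piece.length_of_mem_extensions hb₂]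
  simp [List.getElem?_append_right, add_assoc]

theorem getElem?_of_mem_extensions_cup {e : Bool}
    (ha : a.length = (Slice.mk l (.cup e) r).dom.length)
    (hb : b ∈ extensions ⟨l, .cup e, r⟩ a) : b[l.length]? = b[l.length + 1]? := by
  obtain ⟨a₁, a₂, b₂, a₃, rfl, rfl, h₁, h₂, -, hb₂⟩ := exists_of_mem_extensions ha hb
  obtain rfl := List.eq_nil_of_length_eq_zero h₂
  simp only at h₁
  have hb₂ : b₂ = [false, false] ∨ b₂ = [true, true] := by simpa [Piece.extensions] using hb₂
  rcases hb₂ with rfl | rfl <;> simp [← h₁]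

theorem getElem?_of_mem_extensions_cap {e : Bool}
    (ha : a.length = (Slice.mk l (.cap e) r).dom.length)
    (hb : b ∈ extensions ⟨l, .cap e, r⟩ a) : a[l.length]? = a[l.length + 1]? := by
  obtain ⟨a₁, a₂, b₂, a₃, rfl, rfl, h₁, h₂, -, hb₂⟩ := exists_of_mem_extensions ha hb
  obtain ⟨u, v, rfl⟩ := List.length_eq_two.1 h₂
  obtain rfl : u = v := by
    by_contra huv
    simp [Piece.extensions, huv] at hb₂
  simp only at h₁
  simp [← h₁]

theorem getElem?_of_mem_extensions_cross {c d p : Bool}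
    (ha : a.length = (Slice.mk l (.cross c d p) r).dom.length)
    (hb : b ∈ extensions ⟨l, .cross c d p, r⟩ a) :
    b[l.length + 1]? = a[l.length]? ∧ b[l.length]? = a[l.length + 1]? := by
  obtain ⟨a₁, a₂, b₂, a₃, rfl, rfl, h₁, h₂, -, hb₂⟩ := exists_of_mem_extensions ha hb
  obtain ⟨u, v, rfl⟩ := List.length_eq_two.1 h₂
  obtain rfl : b₂ = [v, u] := by simpa [Piece.extensions] using hb₂
  simp only at h₁
  simp [← h₁]

end Slice

/-- The colour of a point in a colouring; `false` is a junk value outside of the diagram. -/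
def colorAt (P : Stream' (List Bool)) (q : ℕ × ℕ) : Bool := ((P.get q.1)[q.2]?).getD false

theorem JoinedInSlice.colorAt_eq {s t a : List Bool} {w : List Slice} {P : Stream' (List Bool)}
    (hw : IsTangle s w t) (ha : a.length = s.length) (hP : P ∈ tangleColorings w a) {q r : ℕ × ℕ}
    (h : JoinedInSlice w q r) : colorAt P q = colorAt P r := by
  refine congrArg (Option.getD · false) ?_
  have length_eq {k x} (hk : w[k]? = some x) := hw.length_get ha hP hk
  have mem {k x} (hk : w[k]? = some x) := get_succ_mem_extensions hP hk
  cases h with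
  | left k j x hk hj =>
    exact (Slice.getElem?_left_of_mem_extensions (length_eq hk) (mem hk) hj).symm
  | right k j x hk hj =>
    exact (Slice.getElem?_right_of_mem_extensions (length_eq hk) (mem hk) j).symm
  | cup k l r e hk => exact Slice.getElem?_of_mem_extensions_cup (length_eq hk) (mem hk)
  | cap k l r e hk => exact Slice.getElem?_of_mem_extensions_cap (length_eq hk) (mem hk)
  | cross_right k l r c d p hk =>
    exact (Slice.getElem?_of_mem_extensions_cross (length_eq hk) (mem hk)).1.symm
  | cross_left k l r c d p hk =>
    exact (Slice.getElem?_of_mem_extensions_cross (length_eq hk) (mem hk)).2.symm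

theorem finite_isPoint (w : List Slice) : {q | IsPoint w q}.Finite := by
  refine Set.Finite.subset ((Set.finite_lt_nat w.length).prod
    (Set.finite_lt_nat (w.map fun x => x.dom.length).sum)) ?_
  rintro ⟨k, j⟩ ⟨x, hx, hj⟩
  obtain ⟨hk, rfl⟩ := List.getElem?_eq_some_iff.1 hx
  exact ⟨hk, hj.trans_le (List.le_sum_of_mem (List.mem_map_of_mem (List.getElem_mem hk)))⟩

theorem IsTangle.eq_of_colorAt_eq {s a b : List Bool} {w : List Slice} {P Q : Stream' (List Bool)}
    (hw : IsTangle s w []) (ha : a.length = s.length) (hb : b.length = s.length)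
    (hP : P ∈ tangleColorings w a) (hQ : Q ∈ tangleColorings w b)
    (hPQ : ∀ q, IsPoint w q → colorAt P q = colorAt Q q) : P = Q := by
  refine Stream'.ext fun k => ?_
  rcases lt_or_ge k w.length with hk | hk
  · have hx : w[k]? = some w[k] := List.getElem?_eq_getElem hk
    have hPk := hw.length_get ha hP hx
    have hQk := hw.length_get hb hQ hx
    refine List.ext_getElem (hPk.trans hQk.symm) fun j hj hj' => ?_
    simpa [colorAt, hj, hj'] using hPQ (k, j) ⟨_, hx, hPk ▸ hj⟩
  · rw [List.eq_nil_of_length_eq_zero (hw.length_get_of_le ha hP hk),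
      List.eq_nil_of_length_eq_zero (hw.length_get_of_le hb hQ hk)]

theorem LinkDiagram.coloringCount_le (D : LinkDiagram) :
    D.coloringCount ≤ 2 ^ D.componentCount := by
  have : Finite {q // IsPoint D.slices q} := finite_isPoint D.slices
  let colorings : Finset (Stream' (List Bool)) := ⟨_, nodup_tangleColorings D.slices []⟩
  let componentColors (P : colorings) : Quot (fun q r : {q // IsPoint D.slices q} =>
      JoinedInSlice D.slices q.1 r.1) → Bool :=
    Quot.lift (fun q => colorAt P q.1) fun _ _ h => h.colorAt_eq D.closed rfl P.2
  have injective : Function.Injective componentColors := fun P Q hPQ =>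
    Subtype.ext (D.closed.eq_of_colorAt_eq rfl rfl P.2 Q.2 fun q hq =>
      congrFun hPQ (Quot.mk _ ⟨q, hq⟩))
  calc D.coloringCount = Nat.card colorings := by
        rw [Nat.card_eq_fintype_card, Fintype.card_coe]
        exact (card_tangleColorings _ _).symm
    _ ≤ _ := Nat.card_le_card_of_injective componentColors injective
    _ = 2 ^ D.componentCount := by
        rw [Nat.card_fun, Nat.card_eq_fintype_card, Fintype.card_bool]; rfl

theorem Link.IsKnot.coloringCount_le_two {L : Link} (h : L.IsKnot) : L.coloringCount ≤ 2 := by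
  obtain ⟨D, rfl, hD⟩ := h
  exact D.coloringCount_le.trans_eq (by rw [hD, pow_one])

/-! ## Braids and their permutations -/

section

variable {n : ℕ}

theorem swap_mul_swap_mul_swap_comm {α : Type*} [DecidableEq α] {a b c : α} (hab : a ≠ b)
    (hbc : b ≠ c) (hac : a ≠ c) :
    Equiv.swap a b * Equiv.swap b c * Equiv.swap a b =
      Equiv.swap b c * Equiv.swap a b * Equiv.swap b c := by
  rw [Equiv.swap_mul_swap_mul_swap hab hac, Equiv.swap_comm a b, Equiv.swap_comm b c,
    Equiv.swap_mul_swap_mul_swap hbc.symm hac.symm, Equiv.swap_comm]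

/-- The transposition of the `i`-th and the `(i + 1)`-st strand. -/
def adjacentSwap (i : Fin (n - 1)) : Equiv.Perm (Fin n) :=
  Equiv.swap ⟨i, by omega⟩ ⟨i + 1, by omega⟩

theorem adjacentSwap_braid {i j : Fin (n - 1)} (h : (j : ℕ) = i + 1) :
    adjacentSwap i * adjacentSwap j * adjacentSwap i =
      adjacentSwap j * adjacentSwap i * adjacentSwap j := by
  simp only [adjacentSwap, h]
  exact swap_mul_swap_mul_swap_comm (by simp) (by simp) (by simp; omega)

theorem adjacentSwap_commute {i j : Fin (n - 1)} (h : (i : ℕ) + 2 ≤ j) :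
    Commute (adjacentSwap i) (adjacentSwap j) := by
  refine (Equiv.Perm.disjoint_swap_swap ?_).commute
  simp [Fin.ext_iff]
  omega

theorem adjacentSwap_braidRels (n : ℕ) :
    ∀ r ∈ braidRels n, FreeGroup.lift (adjacentSwap (n := n)) r = 1 := by
  rintro r (⟨i, j, h, rfl⟩ | ⟨i, j, h, rfl⟩)
  · rw [map_mul, map_inv, mul_inv_eq_one]
    simpa only [map_mul, FreeGroup.lift_apply_of] using adjacentSwap_braid h
  · rw [map_mul, map_inv, mul_inv_eq_one]
    simpa only [map_mul, FreeGroup.lift_apply_of] using (adjacentSwap_commute h).eq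

/-- The permutation of the strands of a braid.  Its kernel consists of the pure braids. -/
def strandPerm : BraidGroup n →* Equiv.Perm (Fin n) :=
  PresentedGroup.toGroup (adjacentSwap_braidRels n)

theorem braidOfWord_append (u v : List (Fin (n - 1) × Bool)) :
    braidOfWord (u ++ v) = braidOfWord u * braidOfWord v :=
  (congrArg (PresentedGroup.mk (braidRels n)) FreeGroup.mul_mk.symm).trans (map_mul _ _ _)

theorem exists_braidOfWord_eq (β : BraidGroup n) : ∃ w, braidOfWord w = β := by
  obtain ⟨x, rfl⟩ := PresentedGroup.mk_surjective _ β
  exact ⟨x.toWord, by rw [braidOfWord, FreeGroup.mk_toWord]⟩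

theorem strandPerm_braidOfWord_cons (x : Fin (n - 1) × Bool) (w : List (Fin (n - 1) × Bool)) :
    strandPerm (braidOfWord (x :: w)) = adjacentSwap x.1 * strandPerm (braidOfWord w) := by
  rw [← List.singleton_append, braidOfWord_append, map_mul]
  congr 1
  change FreeGroup.lift adjacentSwap (FreeGroup.mk [x]) = adjacentSwap x.1
  obtain ⟨i, _ | _⟩ := x
  · simp [adjacentSwap]
  · simp

theorem lk_braidOfWord (w : List (Fin (n - 1) × Bool)) :
    Multiplicative.toAdd (lk (braidOfWord w)) =
      (w.map fun x => (letterSlice n x).piece.sign).sum := by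
  change Multiplicative.toAdd (FreeGroup.lift (fun _ => Multiplicative.ofAdd (1 : ℤ))
    (FreeGroup.mk w)) = _
  rw [FreeGroup.lift_mk]
  induction w with
  | nil => rfl
  | cons x w ih =>
    rw [List.map_cons, List.prod_cons, toAdd_mul, ih, List.map_cons, List.sum_cons]
    obtain ⟨i, _ | _⟩ := x <;> rfl

/-! ## Two-colourings of braid closures -/

theorem Slice.exists_extensions_cross_eq_singleton {l r a : List Bool} (c d p : Bool)
    (ha : a.length = (Slice.mk l (.cross c d p) r).dom.length) :
    ∃ b, extensions ⟨l, .cross c d p, r⟩ a = {b} := by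
  obtain ⟨a₁, a₂, a₃, rfl, h₁, h₂, -⟩ := exists_eq_append_append_of_length_eq ha
  obtain ⟨u, v, rfl⟩ := List.length_eq_two.1 h₂
  exact ⟨_, extensions_append h₁ (.cross c d p) h₂ r a₃⟩

theorem getElem?_ofFn_append (f : Fin n → Bool) (c : List Bool) (i : Fin n) :
    (List.ofFn f ++ c)[(i : ℕ)]? = some (f i) := by
  simp [List.getElem?_append_left]

theorem eq_of_mem_extensions_letterSlice {x : Fin (n - 1) × Bool} {f : Fin n → Bool}
    {b c : List Bool} (hc : c.length = n)
    (hb : b ∈ (letterSlice n x).extensions (List.ofFn f ++ c)) :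
    b = List.ofFn (f ∘ adjacentSwap x.1) ++ c := by
  have ha : (List.ofFn f ++ c).length = (letterSlice n x).dom.length := by
    simp [letterSlice_dom, hc]
  have left {j : ℕ} (hj : j < x.1) : b[j]? = (List.ofFn f ++ c)[j]? :=
    Slice.getElem?_left_of_mem_extensions ha hb (by simpa [letterSlice] using hj)
  have right {j : ℕ} (hj : x.1 + 2 ≤ j) : b[j]? = (List.ofFn f ++ c)[j]? := by
    obtain ⟨j, rfl⟩ := Nat.exists_eq_add_of_le hj
    simpa [letterSlice, Piece.dom, Piece.cod] using
      Slice.getElem?_right_of_mem_extensions ha hb j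
  obtain ⟨cross_right, cross_left⟩ := Slice.getElem?_of_mem_extensions_cross ha hb
  rw [List.length_replicate] at cross_right cross_left
  refine List.ext_getElem? fun j => ?_
  rcases lt_or_ge j n with hj | hj
  · lift j to Fin n using hj
    rw [getElem?_ofFn_append, Function.comp_apply, adjacentSwap, Equiv.swap_apply_def]
    split_ifs with h h'
    · rw [h, cross_left, ← getElem?_ofFn_append]
    · rw [h', cross_right, ← getElem?_ofFn_append]
    · rw [Fin.ext_iff] at h h'
      rw [← getElem?_ofFn_append f c]
      rcases lt_or_gt_of_ne h with hj | hj
      · exact left hj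
      · exact right (Nat.lt_of_le_of_ne hj (Ne.symm h'))
  · rw [right (by omega), List.getElem?_append_right (by simpa using hj),
      List.getElem?_append_right (by simpa using hj), List.length_ofFn, List.length_ofFn]

theorem extensions_letterSlice (x : Fin (n - 1) × Bool) (f : Fin n → Bool) {c : List Bool}
    (hc : c.length = n) :
    (letterSlice n x).extensions (List.ofFn f ++ c) =
      {List.ofFn (f ∘ adjacentSwap x.1) ++ c} := by
  have ha : (List.ofFn f ++ c).length = (letterSlice n x).dom.length := by
    simp [letterSlice_dom, hc]
  obtain ⟨b, hb⟩ : ∃ b, (letterSlice n x).extensions (List.ofFn f ++ c) = {b} :=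
    Slice.exists_extensions_cross_eq_singleton _ _ _ ha
  have hb' := eq_of_mem_extensions_letterSlice hc (hb ▸ Multiset.mem_singleton_self b)
  rw [hb, hb']

theorem tangleExtensions_letters (w : List (Fin (n - 1) × Bool)) (f : Fin n → Bool)
    {c : List Bool} (hc : c.length = n) :
    tangleExtensions (w.map (letterSlice n)) (List.ofFn f ++ c) =
      {List.ofFn (f ∘ strandPerm (braidOfWord w)) ++ c} := by
  induction w generalizing f with
  | nil =>
    have : strandPerm (braidOfWord ([] : List (Fin (n - 1) × Bool))) = 1 := map_one strandPerm
    simp [tangleExtensions, this]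
  | cons x w ih =>
    rw [List.map_cons, tangleExtensions, extensions_letterSlice x f hc, Multiset.singleton_bind,
      ih, strandPerm_braidOfWord_cons, Equiv.Perm.coe_mul, Function.comp_assoc]

theorem coloringCount_braidClosure_mul (α : BraidGroup n) {β : BraidGroup n}
    (hβ : strandPerm β = 1) :
    (braidClosure (α * β)).coloringCount = (braidClosure α).coloringCount := by
  obtain ⟨u, rfl⟩ := exists_braidOfWord_eq α
  obtain ⟨v, rfl⟩ := exists_braidOfWord_eq β
  rw [← braidOfWord_append, braidClosure_braidOfWord, braidClosure_braidOfWord]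
  change (tangleExtensions (closureDiagram (u ++ v)).slices []).card =
    (tangleExtensions (closureDiagram u).slices []).card
  simp only [closureDiagram, List.append_assoc, tangleExtensions_append]
  refine congrArg Multiset.card (Multiset.bind_congr fun a ha => ?_)
  obtain ⟨f, c, hc, rfl⟩ : ∃ (f : Fin n → Bool) (c : List Bool), c.length = n ∧
      a = List.ofFn f ++ c := by
    have h : a.length = n + n := by
      simpa using length_of_mem_tangleExtensions (isTangle_nestedCups n) rfl ha
    refine ⟨fun i => a[i], a.drop n, by simp [h], ?_⟩
    have take_eq : a.take n = List.ofFn fun i : Fin n => a[i] :=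
      List.ext_getElem (by simp [h]) (by simp)
    rw [← take_eq, List.take_append_drop]
  rw [tangleExtensions_letters _ f hc, tangleExtensions_letters _ f hc, braidOfWord_append,
    map_mul, hβ, mul_one]

theorem IsCompletingBraid.braidClosure_eq_unlink_one {α β : BraidGroup n} (hβ : strandPerm β = 1)
    (h : IsCompletingBraid β α) : braidClosure α = unlink 1 := by
  obtain ⟨k, hk, -, hα⟩ := h.isUnlink
  have two_pow_le : 2 ^ k ≤ 2 ^ 1 := by
    rw [← coloringCount_unlink, ← hα, ← coloringCount_braidClosure_mul α hβ]
    exact h.isKnot.coloringCount_le_two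
  rw [hα, le_antisymm ((Nat.pow_le_pow_iff_right one_lt_two).1 two_pow_le) hk]

/-! ## The Bennequin bounds for closed braids -/

/-- The bounds of the knot invariant `I` by the writhe and the number of Seifert circles of every
diagram, as in the Bennequin inequality. -/
def SatisfiesBennequinBounds (I : Knot → ℝ) : Prop :=
  ∀ (K : Knot) (D : LinkDiagram), D.IsDiagramOf K.1 →
    1 + (D.writhe : ℝ) - (D.seifertCount : ℝ) ≤ I K ∧
      I K ≤ -1 + (D.writhe : ℝ) + (D.seifertCount : ℝ)

theorem sum_sign_nestedCups (n : ℕ) : ((nestedCups n).map fun x => x.piece.sign).sum = 0 := by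
  induction n with
  | zero => rfl
  | succ n ih => rw [nestedCups, List.map_append, List.sum_append, ih]; rfl

theorem sum_sign_nestedCaps (n : ℕ) : ((nestedCaps n).map fun x => x.piece.sign).sum = 0 := by
  induction n with
  | zero => rfl
  | succ n ih => rw [nestedCaps, List.map_cons, List.sum_cons, ih]; rfl

theorem writhe_closureDiagram (w : List (Fin (n - 1) × Bool)) :
    (closureDiagram w).writhe = Multiplicative.toAdd (lk (braidOfWord w)) := by
  simp only [LinkDiagram.writhe, closureDiagram, List.map_append, List.sum_append,
    sum_sign_nestedCups, sum_sign_nestedCaps, List.map_map, zero_add, add_zero, lk_braidOfWord,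
    Function.comp_def]

theorem seifertCount_closureDiagram (w : List (Fin (n - 1) × Bool)) :
    (closureDiagram w).seifertCount = (closureDiagram (n := n) []).seifertCount := by
  have smooth_letters : (w.map (letterSlice n)).flatMap Slice.smooth = [] := by
    refine List.flatMap_eq_nil_iff.2 fun x hx => ?_
    obtain ⟨y, -, rfl⟩ := List.mem_map.1 hx
    simp [letterSlice, Slice.smooth]
  simp [LinkDiagram.seifertCount, closureDiagram, List.flatMap_append, smooth_letters]

theorem SatisfiesBennequinBounds.abs_sub_lk_le {I : Knot → ℝ} (hI : SatisfiesBennequinBounds I)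
    {K : Knot} {β : BraidGroup n} (h : braidClosure β = K.1) :
    |I K - (Multiplicative.toAdd (lk β) : ℤ)| ≤
      (closureDiagram (n := n) []).seifertCount - 1 := by
  obtain ⟨w, rfl⟩ := exists_braidOfWord_eq β
  obtain ⟨h₁, h₂⟩ := hI K (closureDiagram w) ((braidClosure_braidOfWord w).symm.trans h)
  rw [writhe_closureDiagram, seifertCount_closureDiagram] at h₁ h₂
  exact abs_sub_le_iff.2 ⟨by linarith, by linarith⟩

end

/-! ## Quasi-morphisms close to homomorphisms -/

section

variable {G : Type*} [Group G] {φ : G → ℝ}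

theorem IsQuasimorphism.sub_monoidHom (hφ : IsQuasimorphism φ) (f : G →* Multiplicative ℝ) :
    IsQuasimorphism fun a => φ a - Multiplicative.toAdd (f a) := by
  obtain ⟨C, hC, h⟩ := hφ
  refine ⟨C, hC, fun a b => ?_⟩
  have sub_eq : φ (a * b) - Multiplicative.toAdd (f (a * b)) - (φ a - Multiplicative.toAdd (f a)) -
      (φ b - Multiplicative.toAdd (f b)) = φ (a * b) - φ a - φ b := by
    rw [map_mul, toAdd_mul]
    ring
  exact sub_eq ▸ h a b

theorem IsQuasimorphism.exists_abs_le_of_finiteIndex (hφ : IsQuasimorphism φ) (H : Subgroup G)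
    [H.FiniteIndex] {B : ℝ} (hB : ∀ a ∈ H, |φ a| ≤ B) : ∃ B', ∀ a, |φ a| ≤ B' := by
  obtain ⟨C, -, hC⟩ := hφ
  obtain ⟨R, hR⟩ : ∃ R, ∀ q : G ⧸ H, |φ q.out| ≤ R := by
    obtain ⟨R, hR⟩ := (Set.finite_range fun q : G ⧸ H => |φ q.out|).bddAbove
    exact ⟨R, fun q => hR ⟨q, rfl⟩⟩
  refine ⟨C + R + B, fun a => ?_⟩
  obtain ⟨h, hh⟩ := QuotientGroup.mk_out_eq_mul H a
  have hq := hR (QuotientGroup.mk a)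
  have ha := hC (QuotientGroup.mk a : G ⧸ H).out (h : G)⁻¹
  rw [hh, mul_inv_cancel_right] at ha
  rw [hh] at hq
  calc |φ a| = |(φ a - φ (a * h) - φ (h : G)⁻¹) + φ (a * h) + φ (h : G)⁻¹| := by ring_nf
    _ ≤ |φ a - φ (a * h) - φ (h : G)⁻¹| + |φ (a * h)| + |φ (h : G)⁻¹| := abs_add_three _ _ _
    _ ≤ C + R + B := by gcongr; exact hB _ (H.inv_mem h.2)

theorem tendsto_div_of_abs_sub_monoidHom_le {f : G →* Multiplicative ℝ} {B : ℝ}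
    (hB : ∀ a, |φ a - Multiplicative.toAdd (f a)| ≤ B) (a : G) :
    Tendsto (fun k : ℕ => φ (a ^ k) / k) atTop (𝓝 (Multiplicative.toAdd (f a))) := by
  rw [← tendsto_sub_nhds_zero_iff]
  refine squeeze_zero_norm' ?_ (tendsto_const_div_atTop_nhds_zero_nat B)
  filter_upwards [eventually_gt_atTop 0] with k hk
  have hk : (0 : ℝ) < k := Nat.cast_pos.2 hk
  have h := hB (a ^ k)
  rw [map_pow, toAdd_pow, nsmul_eq_mul] at h
  rw [Real.norm_eq_abs, div_sub' hk.ne', abs_div, abs_of_pos hk]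
  gcongr

end

section

variable {n : ℕ} {I : Knot → ℝ} {α : BraidGroup n → BraidGroup n}
  {hα : ∀ β, IsCompletingBraid β (α β)}

theorem abs_inducedFunction_sub_lk_le_of_strandPerm_eq_one (hI : SatisfiesBennequinBounds I)
    {β : BraidGroup n} (hβ : strandPerm β = 1) :
    |inducedFunction I α hα β - (Multiplicative.toAdd (lk β) : ℤ)| ≤
      |inducedFunction I α hα 1| + 2 * ((closureDiagram (n := n) []).seifertCount - 1) := by
  have unknot : braidClosure (α β) = braidClosure (α 1 * 1) := by
    rw [(hα β).braidClosure_eq_unlink_one hβ, mul_one,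
      (hα 1).braidClosure_eq_unlink_one (map_one strandPerm)]
  have h₁ : |inducedFunction I α hα 1 - (Multiplicative.toAdd (lk (α β)) : ℤ)| ≤ _ :=
    hI.abs_sub_lk_le unknot
  have h₂ : |inducedFunction I α hα β - (Multiplicative.toAdd (lk (α β * β)) : ℤ)| ≤ _ :=
    hI.abs_sub_lk_le rfl
  rw [map_mul, toAdd_mul, Int.cast_add] at h₂
  have h₃ := abs_le.1 (le_refl |inducedFunction I α hα 1|)
  rw [abs_le] at *
  constructor <;> linarith

theorem exists_abs_inducedFunction_sub_lk_le (hI : SatisfiesBennequinBounds I)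
    (hquasi : IsQuasimorphism (inducedFunction I α hα)) :
    ∃ B, ∀ β, |inducedFunction I α hα β - (Multiplicative.toAdd (lk β) : ℤ)| ≤ B :=
  (hquasi.sub_monoidHom ((Int.castAddHom ℝ).toMultiplicative.comp lk)).exists_abs_le_of_finiteIndex
    strandPerm.ker fun _ hβ => abs_inducedFunction_sub_lk_le_of_strandPerm_eq_one hI hβ

end

theorem mainTheorem2 (n : ℕ) (I : Knot → ℝ)
    (hI : ∀ (K : Knot) (D : LinkDiagram), D.IsDiagramOf K.1 →
      1 + (D.writhe : ℝ) - (D.seifertCount : ℝ) ≤ I K ∧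
        I K ≤ -1 + (D.writhe : ℝ) + (D.seifertCount : ℝ))
    (α : BraidGroup n → BraidGroup n) (hα : ∀ β, IsCompletingBraid β (α β))
    (hquasi : IsQuasimorphism (inducedFunction I α hα)) :
    ∀ β : BraidGroup n,
      Tendsto (fun k : ℕ => inducedFunction I α hα (β ^ k) / (k : ℝ)) atTop
        (𝓝 (homogenization (inducedFunction I α hα) β)) ∧
      homogenization (inducedFunction I α hα) β = ((Multiplicative.toAdd (lk β) : ℤ) : ℝ) := by
  intro β
  obtain ⟨B, hB⟩ := exists_abs_inducedFunction_sub_lk_le hI hquasi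
  have h : Tendsto (fun k : ℕ => inducedFunction I α hα (β ^ k) / (k : ℝ)) atTop
      (𝓝 ((Multiplicative.toAdd (lk β) : ℤ) : ℝ)) :=
    tendsto_div_of_abs_sub_monoidHom_le (f := (Int.castAddHom ℝ).toMultiplicative.comp lk) hB β
  exact ⟨tendsto_nhds_limUnder ⟨_, h⟩, h.limUnder_eq⟩
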